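/- Let $q$ be a power of a prime $p$, let $n$ be a positive integer, and write $n=p^s n_0$ with $\gcd(n_0,p)=1$. Let $d$ be the least positive integer with $q^d\equiv 1 \pmod{n_0}$, and for $r\ge 1$ let $v_r$ be the number of distinct monic irreducible factors of degree $r$ of $x^n-1$ over $\mathbb{F}_q$. Call $\alpha\in\mathbb{F}_{q^n}$ a $k$-normal element of $\mathbb{F}_{q^n}$ over $\mathbb{F}_q$ if the greatest common divisor of $x^n-1$ and $g_\alpha(x)=\sum_{i=0}^{n-1}\alpha^{q^i}x^{n-1-i}$ in $\mathbb{F}_{q^n}[x]$ has degree $k$ (so $\alpha=0$, for which the greatest common divisor is $x^n-1$, is $n$-normal, while every $\alpha\neq 0$ is $k$-normal for some $k\le n-1$). Then the number $N_2$ of $2$-normal elements of $\mathbb{F}_{q^n}$ over $\mathbb{F}_q$ is $$ N_2=\begin{cases} \left(v_1+\frac12 v_1(v_1-1)+v_2\right)q^{\,n-n_0-2}\displaystyle\prod_{r\mid d}(q^r-1)^{v_r} & \text{if } n\neq n_0 \text{ and } p^s>2;\\[2mm] \left(\frac{q}{q-1}v_1+\frac12 v_1(v_1-1)+v_2\right)q^{\,n-n_0-2}\displaystyle\prod_{r\mid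 d}(q^r-1)^{v_r} & \text{if } n\neq n_0 \text{ and } p^s=2;\\[2mm] \left(\dfrac{v_1(v_1-1)}{2(q-1)^2}+\dfrac{v_2}{q^2-1}\right)\displaystyle\prod_{r\mid d}(q^r-1)^{v_r} & \text{if } n=n_0. \end{cases} $$ -/

import Mathlib

open Polynomial

/-- The polynomial `g_α(x) = ∑_{i=0}^{n-1} α^{q^i} x^{n-1-i}` in `K[x]`, where `q = |F|` and
`n = [K : F]`. -/
noncomputable def conjPoly (F : Type*) {K : Type*} [Field F] [Field K] [Algebra F K] (α : K) :
    K[X] :=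
  ∑ i ∈ Finset.range (Module.finrank F K),
    C (α ^ (Nat.card F ^ i)) * X ^ (Module.finrank F K - 1 - i)

open Classical in
/-- `α` is `k`-normal over `F` if `gcd(x^n - 1, g_α(x))`, taken in `K[x]`, has degree `k`.
For `α ≠ 0` this degree is at most `n - 1`; for `α = 0` the gcd is `x^n - 1`, of degree `n`. -/
def IsKNormal (F : Type*) {K : Type*} [Field F] [Field K] [Algebra F K] (k : ℕ) (α : K) : Prop :=
  (EuclideanDomain.gcd (X ^ Module.finrank F K - 1 : K[X]) (conjPoly F α)).natDegree = k

/-- The number of `k`-normal elements of `K` over `F`. -/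
noncomputable def numKNormal (F K : Type*) [Field F] [Field K] [Algebra F K] (k : ℕ) : ℕ :=
  Set.ncard {α : K | IsKNormal F k α}

/-- `v_r`: the number of distinct monic irreducible factors of `x^n - 1` of degree `r` in `F[x]`. -/
noncomputable def numFactors (F : Type*) [Field F] (n r : ℕ) : ℕ :=
  Set.ncard {g : F[X] | g.Monic ∧ Irreducible g ∧ g.natDegree = r ∧ g ∣ X ^ n - 1}

/-! Let `β` generate a normal basis. Multiplying `g_α` by `x` modulo `x^n - 1` replaces `α` by its
Frobenius image. If `α = ∑ f_i β^{q^i}` with `f_i` in `F`, it follows that `g_α ≡ f g_β`, where `f =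
∑ f_i x^i`. Since `g_β` is a unit modulo `x^n - 1`, `k`-normality says that `gcd(x^n - 1, f)` has
degree `k`, a condition over `F` on polynomials of degree less than `n` (`numKNormal_eq_ncard`).

Grouping these `f` by their monic gcd `g` with `x^n - 1` gives `∑ Φ((x^n - 1)/g)` over the monic
divisors `g` of degree `k` (`ncard_natDegree_gcd_eq_sum`). Here `Φ` is the polynomial totient, with
Euler product `q^{deg h} ∏ (1 - q^{-deg P})` over the `P` dividing `h`.

Write `x^n - 1 = W^t` with `W = x^{n₀} - 1` squarefree and `t = p^s`. For `k = 2`, `g` is an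
irreducible quadratic, a product of two distinct linear factors, or the square of one. The Euler
product of `W^t/g` loses the factor at `P` exactly when `P^t ∣ g`. This never happens for `t > 2`;
it happens only for `g = P^2` when `t = 2`, and for every irreducible factor of `g` when `t = 1`.
Hence the three cases (`sum_polyTotient_div`). -/

/-! ### From `k`-normal elements to polynomials over the base field. -/

section NormalBasis

variable (F K : Type*) [Field F] [Field K] [Algebra F K]

/-- The `i`-th power of the `F`-Frobenius `α ↦ α ^ |F| ^ i`, as an automorphism of `K`. -/
noncomputable def frobPow [Finite F] [Finite K] (i : ℕ) : Gal(K/F) :=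
  letI := Fintype.ofFinite F
  FiniteField.frobeniusAlgEquivOfAlgebraic F K ^ i

theorem pow_card_pow_finrank [Finite K] (α : K) :
    α ^ Nat.card F ^ Module.finrank F K = α := by
  let := Fintype.ofFinite K
  rw [← Module.natCard_eq_pow_finrank, ← Fintype.card_eq_nat_card, FiniteField.pow_card]

variable [Finite F] [Finite K]

theorem frobPow_apply (i : ℕ) (α : K) : frobPow F K i α = α ^ Nat.card F ^ i := by
  let := Fintype.ofFinite F
  rw [frobPow, AlgEquiv.coe_pow, FiniteField.coe_frobeniusAlgEquivOfAlgebraic_iterate,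
    Fintype.card_eq_nat_card]

theorem frobPow_bijective :
    Function.Bijective fun i : Fin (Module.finrank F K) ↦ frobPow F K i := by
  let := Fintype.ofFinite F
  exact FiniteField.bijective_frobeniusAlgEquivOfAlgebraic_pow F K

theorem exists_frobPow_basis :
    ∃ (b : Module.Basis (Fin (Module.finrank F K)) F K) (β : K),
      ∀ i, b i = β ^ Nat.card F ^ (i : ℕ) := by
  refine ⟨(IsGalois.normalBasis F K).reindex (Equiv.ofBijective _ (frobPow_bijective F K)).symm,
    IsGalois.normalBasis F K 1, fun i ↦ ?_⟩
  rw [Module.Basis.reindex_apply, Equiv.symm_symm, Equiv.ofBijective_apply,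
    IsGalois.normalBasis_apply, frobPow_apply]

/-- `conjPoly` as an `F`-linear map. -/
noncomputable def conjPolyLinear : K →ₗ[F] K[X] where
  toFun := conjPoly F
  map_add' x y := by
    simp only [conjPoly, ← frobPow_apply F K, map_add, add_mul, Finset.sum_add_distrib]
  map_smul' a x := by
    simp only [conjPoly, ← frobPow_apply F K, map_smul, Finset.smul_sum, RingHom.id_apply]
    refine Finset.sum_congr rfl fun i _ ↦ ?_
    rw [← smul_C, smul_mul_assoc]

variable {F K}

-- The difference telescopes; the two surviving end terms combine because `α^{q^n} = α`.
omit [Finite F] in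
theorem X_mul_conjPoly_sub (α : K) :
    X * conjPoly F α - conjPoly F (α ^ Nat.card F) =
      C α * (X ^ Module.finrank F K - 1) := by
  set n := Module.finrank F K with hn
  have h := Finset.sum_range_sub
    (fun i ↦ C (α ^ Nat.card F ^ i) * X ^ (n - i) : ℕ → K[X]) n
  simp only [Finset.sum_sub_distrib, pow_zero, pow_one, Nat.sub_self, Nat.sub_zero,
    hn ▸ pow_card_pow_finrank F K α] at h
  have h1 : X * conjPoly F α = ∑ i ∈ Finset.range n, C (α ^ Nat.card F ^ i) * X ^ (n - i) := by
    rw [conjPoly, Finset.mul_sum]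
    refine Finset.sum_congr rfl fun i hi ↦ ?_
    have : n - i = (n - 1 - i) + 1 := by have := Finset.mem_range.1 hi; omega
    rw [← hn, this, pow_succ]; ring
  have h2 : conjPoly F (α ^ Nat.card F) =
      ∑ i ∈ Finset.range n, C (α ^ Nat.card F ^ (i + 1)) * X ^ (n - (i + 1)) := by
    rw [conjPoly]
    refine Finset.sum_congr rfl fun i hi ↦ ?_
    rw [← pow_mul, ← pow_succ', ← hn, Nat.sub_sub, Nat.add_comm 1]
  rw [h1, h2]
  linear_combination -h

omit [Finite F] in
theorem dvd_X_pow_mul_conjPoly_sub (α : K) (j : ℕ) :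
    (X ^ Module.finrank F K - 1 : K[X]) ∣
      X ^ j * conjPoly F α - conjPoly F (α ^ Nat.card F ^ j) := by
  induction j with
  | zero => simp
  | succ j ih =>
    have h : X ^ (j + 1) * conjPoly F α - conjPoly F (α ^ Nat.card F ^ (j + 1)) =
        X * (X ^ j * conjPoly F α - conjPoly F (α ^ Nat.card F ^ j)) +
        (X * conjPoly F (α ^ Nat.card F ^ j) - conjPoly F ((α ^ Nat.card F ^ j) ^ Nat.card F)) := by
      rw [← pow_mul, ← pow_succ]; ring
    rw [h, X_mul_conjPoly_sub]
    exact dvd_add (ih.mul_left _) (dvd_mul_left _ _)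

/-- A trace-dual element `γ` produces an inverse: `(∑ γ^{q^j} x^j) g_β ≡ ∑ γ^{q^j} g_{β^{q^j}} =
x^{n-1}` modulo `x^n - 1`, and `x^{n-1}` is a unit there. -/
theorem isCoprime_conjPoly_of_basis {n : ℕ} (hn : Module.finrank F K = n)
    (b : Module.Basis (Fin n) F K) (β : K) (hb : ∀ i, b i = β ^ Nat.card F ^ (i : ℕ)) :
    IsCoprime (X ^ n - 1 : K[X]) (conjPoly F β) := by
  have hpos : 0 < n := hn ▸ Module.finrank_pos
  have hnd := traceForm_nondegenerate F K
  -- Dual to `β` itself, so that `Tr(γ β^{q^i})` is `1` for `i = 0` and `0` otherwise.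
  set γ := (Algebra.traceForm F K).dualBasis hnd b ⟨0, hpos⟩ with hγ
  have htr (i : ℕ) (hi : i < n) :
      ∑ j ∈ Finset.range n, γ ^ Nat.card F ^ j * (β ^ Nat.card F ^ j) ^ Nat.card F ^ i =
        if i = 0 then 1 else 0 := by
    have h := LinearMap.BilinForm.apply_dualBasis_left hnd b ⟨0, hpos⟩ ⟨i, hi⟩
    rw [← hγ, Algebra.traceForm_apply, hb] at h
    have h' := congrArg (algebraMap F K) h
    rw [FiniteField.algebraMap_trace_eq_sum_pow, hn] at h'
    simp only [Fin.mk.injEq] at h'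
    rw [apply_ite (algebraMap F K), map_one, map_zero] at h'
    rw [← h']
    refine Finset.sum_congr rfl fun j _ ↦ ?_
    rw [mul_pow, ← pow_mul, ← pow_mul, mul_comm (Nat.card F ^ j) (Nat.card F ^ i)]
  have hsum : ∑ j ∈ Finset.range n, C (γ ^ Nat.card F ^ j) * conjPoly F (β ^ Nat.card F ^ j) =
      (X ^ (n - 1) : K[X]) := by
    simp only [conjPoly, Finset.mul_sum, hn]
    -- After the exchange of sums, the coefficient of `X ^ (n - 1 - i)` is `Tr(γ β^{q^i})`.
    rw [Finset.sum_comm, Finset.sum_eq_single_of_mem 0 (Finset.mem_range.2 hpos)]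
    · have := htr 0 hpos
      simp only [← mul_assoc, ← C_mul, ← Finset.sum_mul, ← map_sum, this]
      simp
    · intro i hi hi0
      have := htr i (Finset.mem_range.1 hi)
      simp only [← mul_assoc, ← C_mul, ← Finset.sum_mul, ← map_sum, this]
      simp [hi0]
  have hdvd : (X ^ n - 1 : K[X]) ∣
      (∑ j ∈ Finset.range n, C (γ ^ Nat.card F ^ j) * X ^ j) * conjPoly F β - X ^ (n - 1) := by
    rw [← hsum, Finset.sum_mul, ← Finset.sum_sub_distrib]
    refine Finset.dvd_sum fun j _ ↦ ?_
    rw [mul_assoc, ← mul_sub]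
    exact (hn ▸ dvd_X_pow_mul_conjPoly_sub β j).mul_left _
  obtain ⟨w, hw⟩ := hdvd
  have hX : IsCoprime (X ^ n - 1 : K[X]) (X ^ (n - 1)) := by
    refine ⟨-1, X, ?_⟩
    rw [← pow_succ', Nat.sub_add_cancel hpos]; ring
  rw [show (X ^ (n - 1) : K[X]) =
    (∑ j ∈ Finset.range n, C (γ ^ Nat.card F ^ j) * X ^ j) * conjPoly F β +
      (X ^ n - 1) * (-w) by linear_combination -hw] at hX
  exact hX.of_add_mul_left_right.of_mul_right_right

/-- The coordinates of `α` in the normal basis serve as the coefficients of `f`. By `F`-linearity of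
`conjPoly` it is enough to treat the conjugates of `β`, each of which acts as a power of `X`. -/
theorem dvd_conjPoly_sub_of_basis {n : ℕ} (hn : Module.finrank F K = n)
    (b : Module.Basis (Fin n) F K) (β : K) (hb : ∀ i, b i = β ^ Nat.card F ^ (i : ℕ)) (α : K) :
    (X ^ n - 1 : K[X]) ∣
      ((degreeLTEquiv F n).symm (b.equivFun α) : F[X]).map (algebraMap F K) * conjPoly F β -
        conjPoly F α := by
  have h1 : conjPoly F α = ∑ i, b.repr α i • conjPoly F (b i) := by
    have := congrArg (conjPolyLinear F K) (b.sum_repr α)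
    simpa only [map_sum, map_smul] using! this.symm
  have h2 : ((degreeLTEquiv F n).symm (b.equivFun α) : F[X]) =
      ∑ i : Fin n, monomial (i : ℕ) (b.repr α i) := rfl
  rw [h1, h2, Polynomial.map_sum, Finset.sum_mul, ← Finset.sum_sub_distrib]
  refine Finset.dvd_sum fun i _ ↦ ?_
  rw [map_monomial, ← C_mul_X_pow_eq_monomial, mul_assoc,
    ← algebraMap_smul K (b.repr α i) (conjPoly F (b i)), smul_eq_C_mul, ← mul_sub, hb]
  exact (hn ▸ dvd_X_pow_mul_conjPoly_sub β i).mul_left _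

open Classical in
theorem natDegree_gcd_eq_of_dvd_sub {R : Type*} [Field R] {m g f h : R[X]} (hm : m ≠ 0)
    (hg : IsCoprime m g) (hd : m ∣ f * g - h) :
    (EuclideanDomain.gcd m h).natDegree = (EuclideanDomain.gcd m f).natDegree := by
  have hne (x : R[X]) : EuclideanDomain.gcd m x ≠ 0 := fun h0 ↦
    hm (EuclideanDomain.gcd_eq_zero_iff.1 h0).1
  have h1 : EuclideanDomain.gcd m h ∣ EuclideanDomain.gcd m f := by
    refine EuclideanDomain.dvd_gcd (EuclideanDomain.gcd_dvd_left _ _) ?_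
    have hdm := EuclideanDomain.gcd_dvd_left m h
    refine (hg.of_isCoprime_of_dvd_left hdm).dvd_of_dvd_mul_right ?_
    exact (dvd_sub_left (EuclideanDomain.gcd_dvd_right m h)).1 (hdm.trans hd)
  have h2 : EuclideanDomain.gcd m f ∣ EuclideanDomain.gcd m h := by
    refine EuclideanDomain.dvd_gcd (EuclideanDomain.gcd_dvd_left _ _) ?_
    exact (dvd_sub_right ((EuclideanDomain.gcd_dvd_right m f).mul_right g)).1
      ((EuclideanDomain.gcd_dvd_left m f).trans hd)
  exact le_antisymm (natDegree_le_of_dvd h1 (hne _)) (natDegree_le_of_dvd h2 (hne _))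

open Classical in
theorem isKNormal_iff_of_basis {n : ℕ} (hn : Module.finrank F K = n)
    (b : Module.Basis (Fin n) F K) (β : K) (hb : ∀ i, b i = β ^ Nat.card F ^ (i : ℕ)) (k : ℕ)
    (α : K) :
    IsKNormal F k α ↔ (EuclideanDomain.gcd (X ^ n - 1 : F[X])
      ((degreeLTEquiv F n).symm (b.equivFun α) : F[X])).natDegree = k := by
  have hpos : 0 < n := hn ▸ Module.finrank_pos
  have hm : (X ^ n - 1 : K[X]) ≠ 0 := (monic_X_pow_sub_C (1 : K) hpos.ne').ne_zero
  rw [IsKNormal, hn, natDegree_gcd_eq_of_dvd_sub hm (isCoprime_conjPoly_of_basis hn b β hb)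
    (dvd_conjPoly_sub_of_basis hn b β hb α)]
  -- Both polynomials now have coefficients in `F`, and the gcd is unchanged by field extension.
  have hmap : (X ^ n - 1 : K[X]) = (X ^ n - 1 : F[X]).map (algebraMap F K) := by simp
  rw [hmap, gcd_map, natDegree_map]

open Classical in
/-- The `k`-normal elements are counted by polynomials over the base field. -/
theorem numKNormal_eq_ncard {n : ℕ} (hn : Module.finrank F K = n) (k : ℕ) :
    numKNormal F K k = Set.ncard {f : F[X] | f ∈ degreeLT F n ∧
      (EuclideanDomain.gcd (X ^ n - 1 : F[X]) f).natDegree = k} := by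
  obtain ⟨b, β, hb⟩ := exists_frobPow_basis F K
  subst hn
  let e := b.equivFun.trans (degreeLTEquiv F (Module.finrank F K)).symm
  have himg : {f : F[X] | f ∈ degreeLT F (Module.finrank F K) ∧
      (EuclideanDomain.gcd (X ^ Module.finrank F K - 1 : F[X]) f).natDegree = k} =
      (fun α ↦ (e α : F[X])) '' {α : K | IsKNormal F k α} := by
    ext f
    simp only [Set.mem_ofPred_eq, Set.mem_image, isKNormal_iff_of_basis rfl b β hb]
    constructor
    · rintro ⟨hf, hk⟩
      have he : e (e.symm ⟨f, hf⟩) = ⟨f, hf⟩ := e.apply_symm_apply _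
      refine ⟨e.symm ⟨f, hf⟩, ?_, congrArg Subtype.val he⟩
      rw [← hk]
      exact congrArg (fun g : degreeLT F (Module.finrank F K) ↦
        (EuclideanDomain.gcd (X ^ Module.finrank F K - 1 : F[X]) g).natDegree) he
    · rintro ⟨α, hα, rfl⟩
      exact ⟨(e α).2, hα⟩
  rw [himg]
  exact (Set.ncard_image_of_injective _ (Subtype.val_injective.comp e.injective)).symm

end NormalBasis

/-! ### The totient of a polynomial over a finite field and its Euler product. -/

section Totient

variable {F : Type*} [Field F]

/-- The number of polynomials of degree less than `m` that are coprime to `h`. -/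
noncomputable def numCoprimeLT (h : F[X]) (m : ℕ) : ℕ :=
  Set.ncard {u : F[X] | u ∈ degreeLT F m ∧ IsCoprime h u}

/-- The polynomial analogue of Euler's totient function. -/
noncomputable def polyTotient (h : F[X]) : ℕ :=
  numCoprimeLT h h.natDegree

theorem degree_mul_lt_iff {h u : F[X]} (hh : h ≠ 0) (m : ℕ) :
    (h * u).degree < ((h.natDegree + m : ℕ) : WithBot ℕ) ↔ u.degree < (m : WithBot ℕ) := by
  rcases eq_or_ne u 0 with rfl | hu
  · simp
  · rw [← natDegree_lt_iff_degree_lt hu, ← natDegree_lt_iff_degree_lt (mul_ne_zero hh hu),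
      natDegree_mul hh hu, Nat.add_lt_add_iff_left]

variable [Finite F]

theorem finite_degreeLT (m : ℕ) : {u : F[X] | u ∈ degreeLT F m}.Finite :=
  have : Finite (degreeLT F m) := Finite.of_equiv _ (degreeLTEquiv F m).symm.toEquiv
  Set.toFinite ((degreeLT F m : Submodule F F[X]) : Set F[X])

omit [Finite F] in
theorem ncard_degreeLT (m : ℕ) : Set.ncard {u : F[X] | u ∈ degreeLT F m} = Nat.card F ^ m := by
  rw [← Nat.card_coe_set_eq]
  exact (Nat.card_congr (degreeLTEquiv F m).toEquiv).trans (by rw [Nat.card_fun]; simp)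

-- Division by `h`: the quotient is free of degree less than `m`, and coprimality to `h` depends
-- only on the remainder.
omit [Finite F] in
theorem numCoprimeLT_add {h : F[X]} (hh : h ≠ 0) (m : ℕ) :
    numCoprimeLT h (h.natDegree + m) = Nat.card F ^ m * polyTotient h := by
  rw [polyTotient, numCoprimeLT, numCoprimeLT, ← ncard_degreeLT, ← Set.ncard_prod]
  symm
  refine Set.ncard_congr (fun x _ ↦ h * x.1 + x.2) ?_ ?_ ?_
  · rintro ⟨v, w⟩ ⟨hv, hw, hc⟩
    simp only [Set.mem_ofPred_eq, mem_degreeLT] at hv hw ⊢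
    refine ⟨(degree_add_le _ _).trans_lt (max_lt ((degree_mul_lt_iff hh m).2 hv)
      (hw.trans_le ?_)), ?_⟩
    · exact_mod_cast Nat.le_add_right _ _
    · rw [add_comm]; exact hc.add_mul_left_right v
  · rintro ⟨v, w⟩ ⟨v', w'⟩ ⟨hv, hw, hc⟩ ⟨hv', hw', hc'⟩ he
    simp only [mem_degreeLT, ← degree_eq_natDegree hh] at hw hw'
    dsimp only at he
    have hww : w = w' := by
      refine sub_eq_zero.1 (eq_zero_of_dvd_of_degree_lt (p := h) ⟨v' - v, ?_⟩
        ((degree_sub_le _ _).trans_lt (max_lt hw hw')))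
      linear_combination he
    subst hww
    simpa [hh] using he
  · rintro u ⟨hu, hc⟩
    refine ⟨(u / h, u % h), ⟨?_, ?_, ?_⟩, EuclideanDomain.div_add_mod u h⟩
    · simp only [Set.mem_ofPred_eq, mem_degreeLT] at hu ⊢
      rw [← degree_mul_lt_iff hh, show h * (u / h) = u - u % h from
        eq_sub_of_add_eq (EuclideanDomain.div_add_mod u h)]
      refine (degree_sub_le _ _).trans_lt (max_lt hu ((degree_mod_lt u hh).trans_le ?_))
      rw [degree_eq_natDegree hh]
      exact_mod_cast Nat.le_add_right _ _
    · simpa only [mem_degreeLT, ← degree_eq_natDegree hh] using degree_mod_lt u hh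
    · rw [← EuclideanDomain.div_add_mod u h, add_comm] at hc
      exact hc.of_add_mul_left_right

omit [Finite F] in
theorem polyTotient_mul_of_dvd {P h : F[X]} (hP : P ≠ 0) (hh : h ≠ 0) (hd : P ∣ h) :
    polyTotient (P * h) = Nat.card F ^ P.natDegree * polyTotient h := by
  rw [← numCoprimeLT_add hh, polyTotient, natDegree_mul hP hh, add_comm, numCoprimeLT, numCoprimeLT]
  congr! 4 with u
  rw [IsCoprime.mul_left_iff, and_iff_right_of_imp fun hc ↦ hc.of_isCoprime_of_dvd_left hd]

/-- Among the polynomials of degree less than `deg P + deg h` coprime to `h`, those not coprime to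
`P` are the `P * v` with `v` coprime to `h` and of degree less than `deg h`. The additive form
avoids natural subtraction. -/
theorem polyTotient_mul_of_not_dvd {P h : F[X]} (hP : Irreducible P) (hh : h ≠ 0) (hd : ¬ P ∣ h) :
    polyTotient (P * h) + polyTotient h = Nat.card F ^ P.natDegree * polyTotient h := by
  have hPh : IsCoprime P h := (hP.coprime_iff_not_dvd).2 hd
  rw [← numCoprimeLT_add hh, polyTotient, natDegree_mul hP.ne_zero hh, numCoprimeLT, numCoprimeLT]
  have himg : Set.ncard {u : F[X] | u ∈ degreeLT F h.natDegree ∧ IsCoprime h u} =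
      Set.ncard {u : F[X] | (u ∈ degreeLT F (P.natDegree + h.natDegree) ∧ IsCoprime h u) ∧
        P ∣ u} := by
    rw [← Set.ncard_image_of_injective _ (mul_right_injective₀ hP.ne_zero)]
    congr 1
    ext u
    simp only [Set.mem_image, Set.mem_ofPred_eq, mem_degreeLT]
    constructor
    · rintro ⟨v, ⟨hv, hc⟩, rfl⟩
      exact ⟨⟨(degree_mul_lt_iff hP.ne_zero _).2 hv, hPh.symm.mul_right hc⟩, dvd_mul_right _ _⟩
    · rintro ⟨⟨hu, hc⟩, v, rfl⟩
      exact ⟨v, ⟨(degree_mul_lt_iff hP.ne_zero _).1 hu, hc.of_mul_right_right⟩, rfl⟩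
  change _ + Set.ncard _ = _
  rw [himg, ← Set.ncard_union_eq ?_ ((finite_degreeLT _).subset fun u hu ↦ hu.1)
    ((finite_degreeLT _).subset fun u hu ↦ hu.1.1)]
  · congr 1
    ext u
    simp only [Set.mem_union, Set.mem_ofPred_eq, IsCoprime.mul_left_iff, hP.coprime_iff_not_dvd,
      add_comm h.natDegree]
    tauto
  · rw [Set.disjoint_left]
    rintro u ⟨_, hc⟩ ⟨_, hu⟩
    exact (hP.coprime_iff_not_dvd).1 hc.of_mul_left_left hu

omit [Finite F] in
theorem polyTotient_of_isUnit {h : F[X]} (hh : IsUnit h) : polyTotient h = 1 := by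
  rw [polyTotient, numCoprimeLT, natDegree_eq_zero_of_isUnit hh, Set.ncard_eq_one]
  -- Only `0` has degree less than `0`, and it is coprime to a unit.
  refine ⟨0, ?_⟩
  ext u
  simp only [Set.mem_ofPred_eq, mem_degreeLT, Set.mem_singleton_iff]
  constructor
  · rintro ⟨hu, -⟩
    exact degree_eq_bot.1 (Nat.WithBot.lt_zero_iff.1 (by simpa using hu))
  · rintro rfl
    exact ⟨by simp, isCoprime_zero_right.2 hh⟩

open UniqueFactorizationMonoid in
open Classical in
theorem polyTotient_eq_prod_normalizedFactors {h : F[X]} (hh : h ≠ 0) :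
    (polyTotient h : ℚ) = (Nat.card F : ℚ) ^ h.natDegree *
      ∏ P ∈ (normalizedFactors h).toFinset, (1 - ((Nat.card F : ℚ) ^ P.natDegree)⁻¹) := by
  have hq : (Nat.card F : ℚ) ≠ 0 := by exact_mod_cast Nat.card_pos.ne'
  induction h using UniqueFactorizationMonoid.induction_on_prime with
  | h₁ => exact absurd rfl hh
  | h₂ u hu =>
    rw [polyTotient_of_isUnit hu, natDegree_eq_zero_of_isUnit hu, normalizedFactors_of_isUnit hu]
    simp
  | h₃ h P hh0 hP ih =>
    have ih := ih hh0
    have hirr := hP.irreducible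
    have hmem : normalize P ∈ normalizedFactors h ↔ P ∣ h := by
      rw [Polynomial.mem_normalizedFactors_iff hh0, normalize_dvd_iff]
      exact ⟨fun H ↦ H.2.2, fun H ↦ ⟨(normalize_associated P).symm.irreducible hirr,
        monic_normalize hirr.ne_zero, H⟩⟩
    have hdeg : (normalize P).natDegree = P.natDegree :=
      natDegree_eq_of_degree_eq (degree_normalize)
    rw [normalizedFactors_mul hirr.ne_zero hh0, normalizedFactors_irreducible hirr,
      Multiset.toFinset_add, Multiset.toFinset_singleton, natDegree_mul hirr.ne_zero hh0, pow_add]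
    by_cases hd : P ∣ h
    · rw [polyTotient_mul_of_dvd hirr.ne_zero hh0 hd, Finset.union_eq_right.2
        (Finset.singleton_subset_iff.2 (Multiset.mem_toFinset.2 (hmem.2 hd)))]
      push_cast
      rw [ih]; ring
    · have h1 := polyTotient_mul_of_not_dvd hirr hh0 hd
      have h2 : (polyTotient (P * h) : ℚ) =
          ((Nat.card F : ℚ) ^ P.natDegree - 1) * polyTotient h := by
        have : (polyTotient (P * h) : ℚ) + polyTotient h =
          (Nat.card F : ℚ) ^ P.natDegree * polyTotient h := by exact_mod_cast h1
        linear_combination this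
      rw [← Finset.insert_eq, Finset.prod_insert
        (fun H ↦ hd (hmem.1 (Multiset.mem_toFinset.1 H))), hdeg, h2, ih]
      field_simp

open UniqueFactorizationMonoid in
theorem polyTotient_eq_prod {h : F[X]} (hh : h ≠ 0) {S : Finset F[X]}
    (hS : ∀ P, P ∈ S ↔ Irreducible P ∧ P.Monic ∧ P ∣ h) :
    (polyTotient h : ℚ) = (Nat.card F : ℚ) ^ h.natDegree *
      ∏ P ∈ S, (1 - ((Nat.card F : ℚ) ^ P.natDegree)⁻¹) := by
  classical
  rw [polyTotient_eq_prod_normalizedFactors hh]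
  congr 1
  refine Finset.prod_congr (Finset.ext fun P ↦ ?_) fun _ _ ↦ rfl
  rw [hS, Multiset.mem_toFinset, Polynomial.mem_normalizedFactors_iff hh]

end Totient

/-! ### Fibres of the gcd, and monic divisors of degree two. -/

section Factors

variable {F : Type*} [Field F]

open Classical in
theorem normalize_gcd_eq_iff {g h f : F[X]} (hg : g.Monic) :
    normalize (EuclideanDomain.gcd (g * h) f) = g ↔ ∃ u, IsCoprime h u ∧ g * u = f := by
  constructor
  · intro H
    obtain ⟨u, rfl⟩ : g ∣ f := by
      rw [← H, normalize_dvd_iff]; exact EuclideanDomain.gcd_dvd_right _ _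
    have hd : EuclideanDomain.gcd (g * h) (g * u) ∣ g :=
      (normalize_dvd_iff.1 (dvd_of_eq H))
    obtain ⟨c, hc⟩ := hd
    -- Bézout for the gcd, multiplied by `c`, expresses `g`; cancelling `g` leaves a Bézout relation
    -- between `h` and `u`.
    rw [EuclideanDomain.gcd_eq_gcd_ab (g * h) (g * u)] at hc
    refine ⟨u, ⟨c * EuclideanDomain.gcdA (g * h) (g * u),
      c * EuclideanDomain.gcdB (g * h) (g * u), mul_left_cancel₀ hg.ne_zero ?_⟩, rfl⟩
    linear_combination -hc
  · rintro ⟨u, ⟨a, b, hab⟩, rfl⟩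
    rw [← hg.normalize_eq_self, normalize_eq_normalize_iff, hg.normalize_eq_self]
    refine ⟨?_, EuclideanDomain.dvd_gcd (dvd_mul_right _ _) (dvd_mul_right _ _)⟩
    have h1 : g = g * h * a + g * u * b := by linear_combination (-g) * hab
    conv_rhs => rw [h1]
    exact dvd_add ((EuclideanDomain.gcd_dvd_left _ _).mul_right _)
      ((EuclideanDomain.gcd_dvd_right _ _).mul_right _)

-- The fibre over a monic divisor `g` consists of the `g * u` with `u` coprime to `m / g` and of
-- degree less than that of `m / g`, so its size is a totient.
open Classical in
theorem ncard_natDegree_gcd_eq_sum [Finite F] {m : F[X]} (hm : m ≠ 0) (k : ℕ) {D : Finset F[X]}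
    (hD : ∀ g, g ∈ D ↔ g.Monic ∧ g ∣ m ∧ g.natDegree = k) :
    Set.ncard {f : F[X] | f ∈ degreeLT F m.natDegree ∧
      (EuclideanDomain.gcd m f).natDegree = k} = ∑ g ∈ D, polyTotient (m / g) := by
  have hfin : {f : F[X] | f ∈ degreeLT F m.natDegree ∧
      (EuclideanDomain.gcd m f).natDegree = k}.Finite :=
    (finite_degreeLT _).subset fun f hf ↦ hf.1
  have hdeg (f : F[X]) : (normalize (EuclideanDomain.gcd m f)).natDegree =
      (EuclideanDomain.gcd m f).natDegree := natDegree_eq_of_degree_eq degree_normalize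
  have hne (f : F[X]) : EuclideanDomain.gcd m f ≠ 0 := fun h0 ↦
    hm (EuclideanDomain.gcd_eq_zero_iff.1 h0).1
  rw [Set.ncard_eq_toFinset_card _ hfin, Finset.card_eq_sum_card_fiberwise (t := D)
    (f := fun f ↦ normalize (EuclideanDomain.gcd m f))]
  · refine Finset.sum_congr rfl fun g hg ↦ ?_
    obtain ⟨hgm, ⟨h, rfl⟩, hgk⟩ := (hD g).1 hg
    have hh : h ≠ 0 := right_ne_zero_of_mul hm
    rw [mul_div_cancel_left₀ _ hgm.ne_zero, polyTotient, numCoprimeLT,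
      ← Set.ncard_image_of_injective _ (mul_right_injective₀ hgm.ne_zero), ← Set.ncard_coe_finset]
    congr 1
    ext f
    simp only [Finset.coe_filter, Set.Finite.mem_toFinset, Set.mem_ofPred_eq, Set.mem_image,
      mem_degreeLT]
    constructor
    · rintro ⟨⟨hf, -⟩, he⟩
      obtain ⟨u, hu, rfl⟩ := (normalize_gcd_eq_iff hgm).1 he
      rw [natDegree_mul hgm.ne_zero hh, degree_mul_lt_iff hgm.ne_zero] at hf
      exact ⟨u, ⟨hf, hu⟩, rfl⟩
    · rintro ⟨u, ⟨hf, hu⟩, rfl⟩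
      have he := (normalize_gcd_eq_iff hgm).2 ⟨u, hu, rfl⟩
      rw [natDegree_mul hgm.ne_zero hh, degree_mul_lt_iff hgm.ne_zero, ← hdeg, he]
      exact ⟨⟨hf, hgk⟩, rfl⟩
  · intro f hf
    simp only [Set.Finite.coe_toFinset, Set.mem_ofPred_eq] at hf
    refine (hD _).2 ⟨monic_normalize (hne f), ?_, by rw [hdeg, hf.2]⟩
    rw [normalize_dvd_iff]
    exact EuclideanDomain.gcd_dvd_left _ _

theorem Polynomial.Monic.eq_of_irreducible_of_dvd {P Q : F[X]} (hP : P.Monic) (hQ : Q.Monic)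
    (hPi : Irreducible P) (hQi : Irreducible Q) (h : P ∣ Q) : P = Q :=
  eq_of_monic_of_associated hP hQ (hPi.associated_of_dvd hQi h)

theorem Polynomial.Monic.eq_sq_of_sq_dvd {P g : F[X]} (hP : P.Monic) (hPi : Irreducible P)
    (hg : g.Monic) (hdeg : g.natDegree = 2) (h : P ^ 2 ∣ g) : P.natDegree = 1 ∧ g = P ^ 2 := by
  have h1 := natDegree_le_of_dvd h hg.ne_zero
  have h2 := hPi.natDegree_pos
  rw [hP.natDegree_pow] at h1
  have h3 : P.natDegree = 1 := by omega
  refine ⟨h3, eq_of_monic_of_dvd_of_natDegree_le (hP.pow 2) hg h ?_⟩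
  rw [hP.natDegree_pow]; omega

theorem Polynomial.Monic.irreducible_or_eq_mul_of_natDegree_eq_two {g : F[X]} (hg : g.Monic)
    (hdeg : g.natDegree = 2) : Irreducible g ∨ ∃ A B : F[X], A.Monic ∧ B.Monic ∧
      A.natDegree = 1 ∧ B.natDegree = 1 ∧ g = A * B := by
  by_cases hi : Irreducible g
  · exact Or.inl hi
  · right
    have hg1 : g ≠ 1 := by rintro rfl; simp at hdeg
    rw [hg.irreducible_iff_natDegree, and_iff_right hg1] at hi
    push Not at hi
    obtain ⟨A, B, hA, hB, rfl, h1, h2⟩ := hi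
    rw [hA.natDegree_mul hB] at hdeg
    exact ⟨A, B, hA, hB, by omega, by omega, rfl⟩

theorem exists_prod_eq_of_mem_powersetCard_two {T S : Finset F[X]}
    (hS : ∀ P ∈ S, Irreducible P ∧ P.Monic ∧ P.natDegree = 1) (hT : T ∈ S.powersetCard 2) :
    ∃ A B, A ∈ S ∧ B ∈ S ∧ A ≠ B ∧ ∏ P ∈ T, P = A * B ∧
      ∀ P : F[X], P.Monic → Irreducible P → (P ∣ A * B ↔ P ∈ T) := by
  classical
  obtain ⟨hTS, hc⟩ := Finset.mem_powersetCard.1 hT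
  obtain ⟨A, B, hne, rfl⟩ := Finset.card_eq_two.1 hc
  have hA : A ∈ S := hTS (by simp)
  have hB : B ∈ S := hTS (by simp)
  refine ⟨A, B, hA, hB, hne, Finset.prod_pair hne, fun P hP hPi ↦ ?_⟩
  rw [hPi.prime.dvd_mul, Finset.mem_insert, Finset.mem_singleton]
  refine or_congr ⟨fun h ↦ ?_, fun h ↦ h ▸ dvd_rfl⟩ ⟨fun h ↦ ?_, fun h ↦ h ▸ dvd_rfl⟩
  · exact hP.eq_of_irreducible_of_dvd (hS A hA).2.1 hPi (hS A hA).1 h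
  · exact hP.eq_of_irreducible_of_dvd (hS B hB).2.1 hPi (hS B hB).1 h

open Classical in
/-- A sum over the monic divisors of degree two, split according to their factorization. -/
theorem sum_monic_dvd_natDegree_two {M : Type*} [AddCommMonoid M] {m : F[X]}
    {S D : Finset F[X]}
    (hS : ∀ P, P ∈ S ↔ Irreducible P ∧ P.Monic ∧ P ∣ m)
    (hD : ∀ g, g ∈ D ↔ g.Monic ∧ g ∣ m ∧ g.natDegree = 2) (φ : F[X] → M) :
    ∑ g ∈ D, φ g = ∑ P ∈ S with P.natDegree = 2, φ P +
      ∑ T ∈ (S.filter (·.natDegree = 1)).powersetCard 2, φ (∏ P ∈ T, P) +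
      ∑ P ∈ S with P.natDegree = 1 ∧ P ^ 2 ∣ m, φ (P ^ 2) := by
  set S₁ := S.filter (·.natDegree = 1) with hS₁
  have hS₁' (P) (hP : P ∈ S₁) : Irreducible P ∧ P.Monic ∧ P.natDegree = 1 := by
    rw [hS₁, Finset.mem_filter, hS] at hP
    exact ⟨hP.1.1, hP.1.2.1, hP.2⟩
  -- The pair `T` is recovered from its product as the set of monic irreducible divisors.
  have hB : Set.InjOn (fun T : Finset F[X] ↦ ∏ P ∈ T, P) (S₁.powersetCard 2) := by
    intro T hT T' hT' he
    obtain ⟨A, B, hA, hB, -, hp, hd⟩ := exists_prod_eq_of_mem_powersetCard_two hS₁' hT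
    obtain ⟨A', B', hA', hB', -, hp', hd'⟩ := exists_prod_eq_of_mem_powersetCard_two hS₁' hT'
    have he' : A * B = A' * B' := by rw [← hp, ← hp']; exact he
    have hmem (P : F[X]) (hP : P ∈ S₁) : P ∈ T ↔ P ∈ T' := by
      rw [← hd P (hS₁' P hP).2.1 (hS₁' P hP).1, ← hd' P (hS₁' P hP).2.1 (hS₁' P hP).1, he']
    ext P
    exact ⟨fun h ↦ (hmem P ((Finset.mem_powersetCard.1 hT).1 h)).1 h,
      fun h ↦ (hmem P ((Finset.mem_powersetCard.1 hT').1 h)).2 h⟩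
  have hC : Set.InjOn (fun P : F[X] ↦ P ^ 2)
      (S.filter fun P ↦ P.natDegree = 1 ∧ P ^ 2 ∣ m) := by
    intro P hP Q hQ he
    simp only [Finset.coe_filter, Set.mem_ofPred_eq, hS] at hP hQ
    refine hP.1.2.1.eq_of_irreducible_of_dvd hQ.1.2.1 hP.1.1 hQ.1.1 ?_
    exact hP.1.1.prime.dvd_of_dvd_pow (n := 2) ((dvd_pow_self P two_ne_zero).trans (dvd_of_eq he))
  rw [← Finset.sum_image (f := φ) hB, ← Finset.sum_image (f := φ) hC, ← Finset.sum_union,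
    ← Finset.sum_union]
  · refine Finset.sum_congr (Finset.ext fun g ↦ ?_) fun _ _ ↦ rfl
    rw [hD]
    simp only [Finset.mem_union, Finset.mem_image, Finset.mem_filter, hS]
    constructor
    · rintro ⟨hg, hgm, hdeg⟩
      obtain hi | ⟨A, B, hA, hB, hA1, hB1, rfl⟩ :=
        hg.irreducible_or_eq_mul_of_natDegree_eq_two hdeg
      · exact Or.inl (Or.inl ⟨⟨hi, hg, hgm⟩, hdeg⟩)
      · have hAi := irreducible_of_degree_eq_one
          ((degree_eq_iff_natDegree_eq_of_pos one_pos).2 hA1)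
        have hBi := irreducible_of_degree_eq_one
          ((degree_eq_iff_natDegree_eq_of_pos one_pos).2 hB1)
        have hAm := (dvd_mul_right A B).trans hgm
        have hBm := (dvd_mul_left B A).trans hgm
        rcases eq_or_ne A B with rfl | hne
        · rw [← sq] at hgm ⊢
          exact Or.inr ⟨A, ⟨⟨hAi, hA, hAm⟩, hA1, hgm⟩, rfl⟩
        · refine Or.inl (Or.inr ⟨{A, B}, Finset.mem_powersetCard.2 ⟨?_, Finset.card_pair hne⟩,
            Finset.prod_pair hne⟩)
          simp only [Finset.insert_subset_iff, Finset.singleton_subset_iff, hS₁, Finset.mem_filter,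
            hS]
          exact ⟨⟨⟨hAi, hA, hAm⟩, hA1⟩, ⟨hBi, hB, hBm⟩, hB1⟩
    · rintro ((⟨⟨hi, hg, hgm⟩, hdeg⟩ | ⟨T, hT, rfl⟩) | ⟨P, ⟨⟨hPi, hP, hPm⟩, hP1, hP2⟩, rfl⟩)
      · exact ⟨hg, hgm, hdeg⟩
      · obtain ⟨A, B, hA, hB, hne, hp, hd⟩ := exists_prod_eq_of_mem_powersetCard_two hS₁' hT
        obtain ⟨hAi, hAm, hA1⟩ := hS₁' A hA
        obtain ⟨hBi, hBm, hB1⟩ := hS₁' B hB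
        rw [hp]
        refine ⟨hAm.mul hBm, IsCoprime.mul_dvd ?_ ?_ ?_, ?_⟩
        · rw [hAi.coprime_iff_not_dvd]
          exact fun h ↦ hne (hAm.eq_of_irreducible_of_dvd hBm hAi hBi h)
        · exact ((hS A).1 (Finset.mem_filter.1 hA).1).2.2
        · exact ((hS B).1 (Finset.mem_filter.1 hB).1).2.2
        · rw [hAm.natDegree_mul hBm, hA1, hB1]
      · exact ⟨hP.pow 2, hP2, by rw [hP.natDegree_pow, hP1]⟩
  · rw [Finset.disjoint_left]
    intro g hg hg'
    obtain ⟨P, hP, rfl⟩ := Finset.mem_image.1 hg'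
    rw [Finset.mem_filter, hS] at hP
    rcases Finset.mem_union.1 hg with hg | hg
    · rw [Finset.mem_filter, hS] at hg
      exact not_irreducible_pow (by norm_num) hg.1.1
    · obtain ⟨T, hT, he⟩ := Finset.mem_image.1 hg
      obtain ⟨A, B, hA, hB, hne, hp, hd⟩ := exists_prod_eq_of_mem_powersetCard_two hS₁' hT
      obtain ⟨hAi, hAm, hA1⟩ := hS₁' A hA
      obtain ⟨hBi, hBm, hB1⟩ := hS₁' B hB
      rw [hp] at he
      have h1 := hAm.eq_of_irreducible_of_dvd hP.1.2.1 hAi hP.1.1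
        (hAi.prime.dvd_of_dvd_pow (he ▸ dvd_mul_right A B))
      have h2 := hBm.eq_of_irreducible_of_dvd hP.1.2.1 hBi hP.1.1
        (hBi.prime.dvd_of_dvd_pow (he ▸ dvd_mul_left B A))
      exact hne (h1.trans h2.symm)
  · rw [Finset.disjoint_left]
    intro g hg hg'
    obtain ⟨T, hT, rfl⟩ := Finset.mem_image.1 hg'
    obtain ⟨A, B, hA, hB, hne, hp, hd⟩ := exists_prod_eq_of_mem_powersetCard_two hS₁' hT
    simp only [Finset.mem_filter, hS, hp] at hg
    rcases of_irreducible_mul hg.1.1 with h | h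
    · exact (hS₁' A hA).1.not_isUnit h
    · exact (hS₁' B hB).1.not_isUnit h

end Factors

/-! ### Totients of the cofactors of quadratic divisors of `W ^ t`. -/

section Count

variable {F : Type*} [Field F]

/-- `P` occurs exactly `t` times in `W ^ t`, so it is missing from `h` precisely when `g` takes all
`t` copies. -/
theorem dvd_iff_not_pow_dvd_of_squarefree {P W g h : F[X]} {t : ℕ}
    (hW : Squarefree W) (hP : Irreducible P) (hPW : P ∣ W) (hgh : W ^ t = g * h) :
    P ∣ h ↔ ¬ P ^ t ∣ g := by
  constructor
  · rintro h1 h2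
    have h3 : P ^ t * P ∣ W ^ t := hgh ▸ mul_dvd_mul h2 h1
    obtain ⟨V, rfl⟩ := hPW
    rw [mul_pow] at h3
    have h4 := hP.prime.dvd_of_dvd_pow
      ((mul_dvd_mul_iff_left (pow_ne_zero t hP.ne_zero)).1 h3)
    exact hP.not_isUnit (hW P (mul_dvd_mul_left P h4))
  · intro h1
    by_contra h2
    refine h1 (((hP.coprime_iff_not_dvd.2 h2).pow_left (m := t)).dvd_of_dvd_mul_right ?_)
    exact hgh ▸ pow_dvd_pow_of_dvd hPW t

variable [Finite F]

-- The product on the left restores the Euler factors of the primes exhausted by `g`. The right side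
-- then depends on `g` only through its degree.
open Classical in
theorem polyTotient_div_mul_prod {W g : F[X]} {t : ℕ} (hW : Squarefree W)
    {S : Finset F[X]} (hS : ∀ P, P ∈ S ↔ Irreducible P ∧ P.Monic ∧ P ∣ W)
    (hg : g ∣ W ^ t) :
    (polyTotient (W ^ t / g) : ℚ) * ∏ P ∈ S with P ^ t ∣ g,
      (1 - ((Nat.card F : ℚ) ^ P.natDegree)⁻¹) =
    (Nat.card F : ℚ) ^ (W ^ t).natDegree / (Nat.card F : ℚ) ^ g.natDegree *
      ∏ P ∈ S, (1 - ((Nat.card F : ℚ) ^ P.natDegree)⁻¹) := by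
  have hq : (Nat.card F : ℚ) ≠ 0 := by exact_mod_cast Nat.card_pos.ne'
  obtain ⟨h, hgh⟩ := hg
  have h0 : g * h ≠ 0 := hgh ▸ pow_ne_zero t hW.ne_zero
  have hg0 := left_ne_zero_of_mul h0
  have hh0 := right_ne_zero_of_mul h0
  have hS' (P) : P ∈ S.filter (fun P ↦ ¬ P ^ t ∣ g) ↔ Irreducible P ∧ P.Monic ∧ P ∣ h := by
    rw [Finset.mem_filter, hS]
    constructor
    · rintro ⟨⟨hi, hm, hd⟩, hn⟩
      exact ⟨hi, hm, (dvd_iff_not_pow_dvd_of_squarefree hW hi hd hgh).2 hn⟩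
    · rintro ⟨hi, hm, hd⟩
      have hd' : P ∣ W := hi.prime.dvd_of_dvd_pow (hgh ▸ hd.mul_left g)
      exact ⟨⟨hi, hm, hd'⟩, (dvd_iff_not_pow_dvd_of_squarefree hW hi hd' hgh).1 hd⟩
  rw [hgh, mul_div_cancel_left₀ _ hg0, polyTotient_eq_prod hh0 hS', natDegree_mul hg0 hh0,
    pow_add, mul_div_cancel_left₀ _ (pow_ne_zero _ hq), mul_assoc,
    mul_comm (∏ P ∈ S with ¬ P ^ t ∣ g, _), Finset.prod_filter_mul_prod_filter_not]

omit [Finite F] in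
theorem sum_natDegree_of_squarefree {W : F[X]} (hW : Squarefree W)
    {S : Finset F[X]} (hS : ∀ P, P ∈ S ↔ Irreducible P ∧ P.Monic ∧ P ∣ W) :
    ∑ P ∈ S, P.natDegree = W.natDegree := by
  classical
  have hnd := (UniqueFactorizationMonoid.squarefree_iff_nodup_normalizedFactors hW.ne_zero).1 hW
  have hSe : S.val = UniqueFactorizationMonoid.normalizedFactors W := by
    refine (Multiset.Nodup.ext S.nodup hnd).2 fun P ↦ ?_
    rw [Polynomial.mem_normalizedFactors_iff hW.ne_zero, Finset.mem_val, hS]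
  have hprod : Associated (∏ P ∈ S, P) W := by
    have := UniqueFactorizationMonoid.prod_normalizedFactors hW.ne_zero
    rwa [← hSe, Finset.prod_val] at this
  rw [← natDegree_prod_of_monic _ _ fun P hP ↦ ((hS P).1 hP).2.1]
  exact natDegree_eq_of_degree_eq (degree_eq_degree_of_associated hprod)

/-- Each factor is `q^{-deg P} (q^{deg P} - 1)`. The degrees sum to `deg W` because `W` is
squarefree, and the remaining factors are grouped by degree. -/
theorem prod_one_sub_inv_of_squarefree {W : F[X]} (hW : Squarefree W)
    {S : Finset F[X]} (hS : ∀ P, P ∈ S ↔ Irreducible P ∧ P.Monic ∧ P ∣ W) {d : ℕ} (hd : d ≠ 0)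
    (hdvd : ∀ P ∈ S, P.natDegree ∣ d) :
    ∏ P ∈ S, (1 - ((Nat.card F : ℚ) ^ P.natDegree)⁻¹) =
      ((Nat.card F : ℚ) ^ W.natDegree)⁻¹ *
        ∏ r ∈ d.divisors, ((Nat.card F : ℚ) ^ r - 1) ^ (S.filter (·.natDegree = r)).card := by
  have hq : (Nat.card F : ℚ) ≠ 0 := by exact_mod_cast Nat.card_pos.ne'
  have h1 : ∏ r ∈ d.divisors, ((Nat.card F : ℚ) ^ r - 1) ^ (S.filter (·.natDegree = r)).card =
      ∏ P ∈ S, ((Nat.card F : ℚ) ^ P.natDegree - 1) := by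
    rw [← Finset.prod_fiberwise_of_maps_to (g := natDegree) (t := d.divisors)
      fun P hP ↦ Nat.mem_divisors.2 ⟨hdvd P hP, hd⟩]
    refine Finset.prod_congr rfl fun r _ ↦ (Finset.prod_eq_pow_card fun P hP ↦ ?_).symm
    rw [(Finset.mem_filter.1 hP).2]
  rw [h1, ← sum_natDegree_of_squarefree hW hS, ← Finset.prod_pow_eq_pow_sum,
    ← Finset.prod_inv_distrib, ← Finset.prod_mul_distrib]
  refine Finset.prod_congr rfl fun P _ ↦ ?_
  field_simp

open Classical in
/-- The totients attached to the three kinds of monic quadratic divisors of `W ^ t`. -/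
theorem sum_polyTotient_div {W : F[X]} {t : ℕ} (ht : t ≠ 0) (hW : Squarefree W)
    {S D : Finset F[X]} (hS : ∀ P, P ∈ S ↔ Irreducible P ∧ P.Monic ∧ P ∣ W)
    (hD : ∀ g, g ∈ D ↔ g.Monic ∧ g ∣ W ^ t ∧ g.natDegree = 2) {q c v₁ v₂ : ℚ}
    (hq : (Nat.card F : ℚ) = q)
    (hc : c = q ^ (W ^ t).natDegree / q ^ 2 * ∏ P ∈ S, (1 - (q ^ P.natDegree)⁻¹))
    (hv₁ : ((S.filter (·.natDegree = 1)).card : ℚ) = v₁)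
    (hv₂ : ((S.filter (·.natDegree = 2)).card : ℚ) = v₂) :
    (2 < t → ((∑ g ∈ D, polyTotient (W ^ t / g) : ℕ) : ℚ) =
      (v₁ + 1 / 2 * v₁ * (v₁ - 1) + v₂) * c) ∧
    (t = 2 → ((∑ g ∈ D, polyTotient (W ^ t / g) : ℕ) : ℚ) =
      (q / (q - 1) * v₁ + 1 / 2 * v₁ * (v₁ - 1) + v₂) * c) ∧
    (t = 1 → ((∑ g ∈ D, polyTotient (W ^ t / g) : ℕ) : ℚ) =
      (v₁ * (v₁ - 1) / (2 * (q - 1) ^ 2) + v₂ / (q ^ 2 - 1)) * (q ^ 2 * c)) := by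
  subst hq hv₁ hv₂
  set q : ℚ := (Nat.card F : ℚ) with hq
  have hq1 : 1 < q := by rw [hq]; exact_mod_cast Finite.one_lt_card
  have hq0 : q ≠ 0 := by linarith
  have hq1' : q - 1 ≠ 0 := by linarith
  have hq2' : q ^ 2 - 1 ≠ 0 := by nlinarith
  have hSt (P) : P ∈ S ↔ Irreducible P ∧ P.Monic ∧ P ∣ W ^ t := by
    rw [hS]
    exact and_congr_right fun hi ↦ and_congr_right fun _ ↦ (hi.prime.dvd_pow_iff_dvd ht).symm
  set S₁ := S.filter (·.natDegree = 1) with hS₁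
  have hS₁' (P) (hP : P ∈ S₁) : Irreducible P ∧ P.Monic ∧ P.natDegree = 1 := by
    rw [hS₁, Finset.mem_filter, hS] at hP
    exact ⟨hP.1.1, hP.1.2.1, hP.2⟩
  have hval (g) (hg : g ∈ D) : (polyTotient (W ^ t / g) : ℚ) * ∏ P ∈ S with P ^ t ∣ g,
      (1 - (q ^ P.natDegree)⁻¹) = c := by
    rw [polyTotient_div_mul_prod hW hS ((hD g).1 hg).2.1, ((hD g).1 hg).2.2, ← hc]
  have hval0 (g) (hg : g ∈ D) (hn : ∀ P ∈ S, ¬ P ^ t ∣ g) : (polyTotient (W ^ t / g) : ℚ) = c := by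
    rw [← hval g hg, Finset.filter_false_of_mem hn, Finset.prod_empty, mul_one]
  have hch : ((S₁.powersetCard 2).card : ℚ) = 1 / 2 * (S₁.card : ℚ) * ((S₁.card : ℚ) - 1) := by
    rw [Finset.card_powersetCard, Nat.cast_choose_two]; ring
  have hD₂ (g) (hg : g ∈ S.filter (·.natDegree = 2)) : g ∈ D ∧ Irreducible g := by
    rw [Finset.mem_filter, hSt] at hg
    exact ⟨(hD g).2 ⟨hg.1.2.1, hg.1.2.2, hg.2⟩, hg.1.1⟩
  have hD₁₁ (T) (hT : T ∈ S₁.powersetCard 2) : (∏ P ∈ T, P) ∈ D := by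
    obtain ⟨A, B, hA, hB, hne, hp, hd⟩ := exists_prod_eq_of_mem_powersetCard_two hS₁' hT
    obtain ⟨hAi, hAm, hA1⟩ := hS₁' A hA
    obtain ⟨hBi, hBm, hB1⟩ := hS₁' B hB
    rw [hp, hD]
    refine ⟨hAm.mul hBm, IsCoprime.mul_dvd ?_ ?_ ?_, ?_⟩
    · rw [hAi.coprime_iff_not_dvd]
      exact fun h ↦ hne (hAm.eq_of_irreducible_of_dvd hBm hAi hBi h)
    · exact ((hSt A).1 (Finset.mem_filter.1 hA).1).2.2
    · exact ((hSt B).1 (Finset.mem_filter.1 hB).1).2.2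
    · rw [hAm.natDegree_mul hBm, hA1, hB1]
  have hsq₂ (g) (hg : g ∈ S.filter (·.natDegree = 2)) (P) (hP : P ∈ S) : ¬ P ^ 2 ∣ g := by
    intro h
    obtain ⟨hgD, hgi⟩ := hD₂ g hg
    obtain ⟨hgm, -, hg2⟩ := (hD g).1 hgD
    obtain ⟨hPi, hPm, -⟩ := (hS P).1 hP
    rw [(hPm.eq_sq_of_sq_dvd hPi hgm hg2 h).2] at hgi
    exact not_irreducible_pow (by norm_num) hgi
  have hsq₁₁ (T) (hT : T ∈ S₁.powersetCard 2) (P) (hP : P ∈ S) : ¬ P ^ 2 ∣ ∏ P ∈ T, P := by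
    intro h
    obtain ⟨hgm, -, hg2⟩ := (hD _).1 (hD₁₁ T hT)
    obtain ⟨hPi, hPm, -⟩ := (hS P).1 hP
    have he := (hPm.eq_sq_of_sq_dvd hPi hgm hg2 h).2
    obtain ⟨A, B, hA, hB, hne, hp, hd⟩ := exists_prod_eq_of_mem_powersetCard_two hS₁' hT
    obtain ⟨hAi, hAm, hA1⟩ := hS₁' A hA
    obtain ⟨hBi, hBm, hB1⟩ := hS₁' B hB
    rw [hp] at he
    have h1 := hAm.eq_of_irreducible_of_dvd hPm hAi hPi
      (hAi.prime.dvd_of_dvd_pow (he ▸ dvd_mul_right A B))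
    have h2 := hBm.eq_of_irreducible_of_dvd hPm hBi hPi
      (hBi.prime.dvd_of_dvd_pow (he ▸ dvd_mul_left B A))
    exact hne (h1.trans h2.symm)
  have hDsq (ht2 : 2 ≤ t) (P) (hP : P ∈ S₁) : P ^ 2 ∣ W ^ t ∧ P ^ 2 ∈ D := by
    have h1 : P ^ 2 ∣ W ^ t := (pow_dvd_pow P ht2).trans
      (pow_dvd_pow_of_dvd ((hS P).1 (Finset.mem_filter.1 hP).1).2.2 t)
    obtain ⟨hPi, hPm, hP1⟩ := hS₁' P hP
    exact ⟨h1, (hD _).2 ⟨hPm.pow 2, h1, by rw [hPm.natDegree_pow, hP1]⟩⟩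
  have hfil (ht2 : 2 ≤ t) : (S.filter fun P ↦ P.natDegree = 1 ∧ P ^ 2 ∣ W ^ t) = S₁ := by
    refine Finset.filter_congr fun P hP ↦ and_iff_left_of_imp fun h ↦ ?_
    exact (hDsq ht2 P (Finset.mem_filter.2 ⟨hP, h⟩)).1
  rw [Nat.cast_sum, sum_monic_dvd_natDegree_two hSt hD]
  -- `a` and `b` are the common totients for irreducible quadratics and for products of two distinct
  -- linear factors; `e` is the contribution of the squares.
  have key (a b e : ℚ) (ha : ∀ g ∈ S.filter (·.natDegree = 2), (polyTotient (W ^ t / g) : ℚ) = a)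
      (hb : ∀ T ∈ S₁.powersetCard 2, (polyTotient (W ^ t / ∏ P ∈ T, P) : ℚ) = b) :
      ∑ P ∈ S with P.natDegree = 2, (polyTotient (W ^ t / P) : ℚ) +
      ∑ T ∈ S₁.powersetCard 2, (polyTotient (W ^ t / ∏ P ∈ T, P) : ℚ) + e =
      ((S.filter (·.natDegree = 2)).card : ℚ) * a +
        1 / 2 * (S₁.card : ℚ) * ((S₁.card : ℚ) - 1) * b + e := by
    rw [Finset.sum_congr rfl ha, Finset.sum_congr rfl hb, Finset.sum_const, Finset.sum_const,
      nsmul_eq_mul, nsmul_eq_mul, hch]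
  refine ⟨fun ht3 ↦ ?_, fun ht2 ↦ ?_, fun ht1 ↦ ?_⟩
  -- For `t > 2`, `P ^ t` has degree greater than `2`, so no Euler factor is lost.
  · have hn (g : F[X]) (hg : g ∈ D) (P) (hP : P ∈ S) : ¬ P ^ t ∣ g := by
      intro h
      obtain ⟨hgm, -, hg2⟩ := (hD _).1 hg
      have h1 := natDegree_le_of_dvd h hgm.ne_zero
      have h2 := ((hS P).1 hP).1.natDegree_pos
      rw [natDegree_pow, hg2] at h1
      nlinarith
    rw [key c c _ (fun g hg ↦ hval0 g (hD₂ g hg).1 (hn g (hD₂ g hg).1))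
      (fun T hT ↦ hval0 _ (hD₁₁ T hT) (hn _ (hD₁₁ T hT))), hfil ht3.le,
      Finset.sum_congr rfl (fun P hP ↦ hval0 _ (hDsq ht3.le P hP).2 (hn _ (hDsq ht3.le P hP).2)),
      Finset.sum_const, nsmul_eq_mul]
    ring
  -- For `t = 2`, `g = P ^ 2` exhausts `P` alone, whence the correction `(1 - q⁻¹)⁻¹ = q / (q - 1)`.
  · have hs (P) (hP : P ∈ S₁) : (polyTotient (W ^ t / P ^ 2) : ℚ) = q / (q - 1) * c := by
      obtain ⟨hPi, hPm, hP1⟩ := hS₁' P hP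
      have h1 := hval _ (hDsq ht2.ge P hP).2
      have h2 : (S.filter fun Q ↦ Q ^ t ∣ P ^ 2) = {P} := by
        ext Q
        rw [Finset.mem_filter, Finset.mem_singleton]
        constructor
        · rintro ⟨hQ, hd⟩
          obtain ⟨hQi, hQm, -⟩ := (hS Q).1 hQ
          exact hQm.eq_of_irreducible_of_dvd hPm hQi hPi
            (hQi.prime.dvd_of_dvd_pow ((dvd_pow_self Q ht).trans hd))
        · rintro rfl
          exact ⟨(Finset.mem_filter.1 hP).1, by rw [ht2]⟩
      rw [h2, Finset.prod_singleton, hP1, pow_one] at h1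
      rw [← h1]
      field_simp
    rw [key c c _ (fun g hg ↦ hval0 g (hD₂ g hg).1 fun P hP ↦ ht2 ▸ hsq₂ g hg P hP)
      (fun T hT ↦ hval0 _ (hD₁₁ T hT) fun P hP ↦ ht2 ▸ hsq₁₁ T hT P hP), hfil ht2.ge,
      Finset.sum_congr rfl hs, Finset.sum_const, nsmul_eq_mul]
    ring
  · have h3 : (S.filter fun P ↦ P.natDegree = 1 ∧ P ^ 2 ∣ W ^ t) = ∅ := by
      refine Finset.filter_false_of_mem fun P hP h ↦ ?_
      rw [ht1, pow_one, sq] at h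
      exact ((hS P).1 hP).1.not_isUnit (hW P h.2)
    -- For `t = 1` every prime of `g` is lost: the corrections are `(1 - q⁻²)⁻¹` for an irreducible
    -- quadratic and `(1 - q⁻¹)⁻²` for two linear factors.
    rw [h3, Finset.sum_empty, key (q ^ 2 / (q ^ 2 - 1) * c) (q ^ 2 / (q - 1) ^ 2 * c) 0]
    · field_simp
      ring
    · intro g hg
      have h1 := hval _ (hD₂ g hg).1
      rw [Finset.mem_filter, hS] at hg
      have h2 : (S.filter fun Q ↦ Q ^ t ∣ g) = {g} := by
        ext Q
        rw [Finset.mem_filter, Finset.mem_singleton, ht1, pow_one]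
        constructor
        · rintro ⟨hQ, hd⟩
          obtain ⟨hQi, hQm, -⟩ := (hS Q).1 hQ
          exact hQm.eq_of_irreducible_of_dvd hg.1.2.1 hQi hg.1.1 hd
        · rintro rfl
          exact ⟨(hS Q).2 hg.1, dvd_rfl⟩
      rw [h2, Finset.prod_singleton, hg.2] at h1
      rw [← h1]
      field_simp
    · intro T hT
      have h1 := hval _ (hD₁₁ T hT)
      obtain ⟨A, B, hA, hB, hne, hp, hd⟩ := exists_prod_eq_of_mem_powersetCard_two hS₁' hT
      have hTS := (Finset.mem_powersetCard.1 hT).1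
      have h2 : (S.filter fun Q ↦ Q ^ t ∣ ∏ P ∈ T, P) = T := by
        ext Q
        rw [Finset.mem_filter, ht1, pow_one, hp]
        constructor
        · rintro ⟨hQ, hdvd⟩
          obtain ⟨hQi, hQm, -⟩ := (hS Q).1 hQ
          exact (hd Q hQm hQi).1 hdvd
        · intro hQ
          obtain ⟨hQi, hQm, -⟩ := hS₁' Q (hTS hQ)
          exact ⟨(Finset.mem_filter.1 (hTS hQ)).1, (hd Q hQm hQi).2 hQ⟩
      have h4 : ∏ P ∈ T, (1 - (q ^ P.natDegree)⁻¹) = (1 - q⁻¹) ^ 2 := by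
        rw [← (Finset.mem_powersetCard.1 hT).2]
        refine Finset.prod_eq_pow_card fun P hP ↦ ?_
        rw [(hS₁' P (hTS hP)).2.2, pow_one]
      rw [h2, h4] at h1
      rw [← h1]
      field_simp

end Count

/-! ### The count of `2`-normal elements. -/

theorem mainTheorem4 {F K : Type*} [Field F] [Finite F] [Field K] [Finite K] [Algebra F K]
    (p q n s n₀ d : ℕ) [CharP F p]
    (hq : Nat.card F = q) (hn : Module.finrank F K = n)
    (hn₀ : n = p ^ s * n₀) (hcop : Nat.gcd n₀ p = 1)
    (hd : IsLeast {m : ℕ | 0 < m ∧ q ^ m ≡ 1 [MOD n₀]} d) :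
    (n ≠ n₀ → 2 < p ^ s →
      (numKNormal F K 2 : ℚ) =
        ((numFactors F n 1 : ℚ) + 1 / 2 * (numFactors F n 1 : ℚ) * ((numFactors F n 1 : ℚ) - 1)
            + (numFactors F n 2 : ℚ))
          * (q : ℚ) ^ ((n : ℤ) - (n₀ : ℤ) - 2)
          * ∏ r ∈ d.divisors, ((q : ℚ) ^ r - 1) ^ numFactors F n r) ∧
    (n ≠ n₀ → p ^ s = 2 →
      (numKNormal F K 2 : ℚ) =
        ((q : ℚ) / ((q : ℚ) - 1) * (numFactors F n 1 : ℚ)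
            + 1 / 2 * (numFactors F n 1 : ℚ) * ((numFactors F n 1 : ℚ) - 1)
            + (numFactors F n 2 : ℚ))
          * (q : ℚ) ^ ((n : ℤ) - (n₀ : ℤ) - 2)
          * ∏ r ∈ d.divisors, ((q : ℚ) ^ r - 1) ^ numFactors F n r) ∧
    (n = n₀ →
      (numKNormal F K 2 : ℚ) =
        ((numFactors F n 1 : ℚ) * ((numFactors F n 1 : ℚ) - 1) / (2 * ((q : ℚ) - 1) ^ 2)
            + (numFactors F n 2 : ℚ) / ((q : ℚ) ^ 2 - 1))
          * ∏ r ∈ d.divisors, ((q : ℚ) ^ r - 1) ^ numFactors F n r) := by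
  classical
  have hpos : 0 < n := hn ▸ Module.finrank_pos
  have hp : p.Prime := CharP.char_is_prime F p
  have : Fact p.Prime := ⟨hp⟩
  have hn₀pos : 0 < n₀ := Nat.pos_of_ne_zero fun h ↦ by simp [hn₀, h] at hpos
  have ht : p ^ s ≠ 0 := pow_ne_zero s hp.ne_zero
  set W : F[X] := X ^ n₀ - 1 with hW
  have hWm : W.Monic := monic_X_pow_sub_C (1 : F) hn₀pos.ne'
  have hWdeg : W.natDegree = n₀ := natDegree_X_pow_sub_C (r := (1 : F))
  have hWt : (X ^ n - 1 : F[X]) = W ^ p ^ s := by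
    rw [hW, sub_pow_char_pow, one_pow, ← pow_mul, hn₀, mul_comm n₀]
  have hWtdeg : (W ^ p ^ s).natDegree = n := by
    rw [← hWt]; exact natDegree_X_pow_sub_C (r := (1 : F))
  have hWsq : Squarefree W := by
    refine (X_pow_sub_one_separable_iff.2 ?_).squarefree
    rw [Ne, CharP.cast_eq_zero_iff F p]
    exact (hp.coprime_iff_not_dvd).1 (Nat.coprime_comm.1 hcop)
  obtain ⟨⟨hd0, hdmod⟩, -⟩ := hd
  set S : Finset F[X] := (UniqueFactorizationMonoid.normalizedFactors W).toFinset with hSdef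
  have hS (P : F[X]) : P ∈ S ↔ Irreducible P ∧ P.Monic ∧ P ∣ W := by
    rw [hSdef, Multiset.mem_toFinset, Polynomial.mem_normalizedFactors_iff hWm.ne_zero]
  have hDfin : {g : F[X] | g.Monic ∧ g ∣ W ^ p ^ s ∧ g.natDegree = 2}.Finite :=
    (finite_degreeLT 3).subset fun g hg ↦ by
      rw [Set.mem_ofPred_eq, mem_degreeLT, degree_eq_natDegree hg.1.ne_zero, hg.2.2]
      norm_num
  have hD (g : F[X]) : g ∈ hDfin.toFinset ↔ g.Monic ∧ g ∣ W ^ p ^ s ∧ g.natDegree = 2 :=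
    hDfin.mem_toFinset
  have hv (r : ℕ) : numFactors F n r = (S.filter (·.natDegree = r)).card := by
    rw [numFactors, ← Set.ncard_coe_finset]
    congr 1
    ext P
    rw [Set.mem_ofPred_eq, Finset.coe_filter, Set.mem_ofPred_eq, hS, hWt]
    constructor
    · rintro ⟨hm, hi, hr, hP⟩
      exact ⟨⟨hi, hm, hi.prime.dvd_of_dvd_pow hP⟩, hr⟩
    · rintro ⟨⟨hi, hm, hP⟩, hr⟩
      exact ⟨hm, hi, hr, hP.trans (dvd_pow_self W ht)⟩
  -- As `n₀` divides `q ^ d - 1`, `P` divides `X ^ q ^ d - X`, whose irreducible factors have degree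
  -- dividing `d`.
  have hdvd (P) (hP : P ∈ S) : P.natDegree ∣ d := by
    obtain ⟨hi, -, hPW⟩ := (hS P).1 hP
    refine hi.natDegree_dvd_of_dvd_X_pow_card_pow_sub_X (hPW.trans ?_)
    rw [hq]
    have hqpos : 0 < q ^ d := pow_pos (hq ▸ Nat.card_pos) d
    obtain ⟨k, hk⟩ := (Nat.modEq_iff_dvd' hqpos).1 hdmod.symm
    have h1 : q ^ d = n₀ * k + 1 := by omega
    rw [h1, pow_succ, ← sub_one_mul, pow_mul]
    exact (sub_one_dvd_pow_sub_one (X ^ n₀ : F[X]) k).mul_right X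
  have hnum : numKNormal F K 2 = ∑ g ∈ hDfin.toFinset, polyTotient (W ^ p ^ s / g) := by
    rw [numKNormal_eq_ncard hn, hWt,
      ← ncard_natDegree_gcd_eq_sum (pow_ne_zero _ hWm.ne_zero) 2 hD, hWtdeg]
  have hqpos : (q : ℚ) ≠ 0 := by rw [← hq]; exact_mod_cast Nat.card_pos.ne'
  have hprod := prod_one_sub_inv_of_squarefree hWsq hS hd0.ne' hdvd
  simp only [hWdeg, hq, ← hv] at hprod
  obtain ⟨h1, h2, h3⟩ := sum_polyTotient_div ht hWsq hS hD (congrArg Nat.cast hq) rfl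
    (congrArg Nat.cast (hv 1).symm) (congrArg Nat.cast (hv 2).symm)
  rw [hWtdeg, hprod] at h1 h2 h3
  -- An integer exponent is needed: it equals `-1` when `p ^ s = 2` and `n₀ = 1`.
  have hpow : (q : ℚ) ^ ((n : ℤ) - (n₀ : ℤ) - 2) = (q : ℚ) ^ n / q ^ 2 * ((q : ℚ) ^ n₀)⁻¹ := by
    rw [zpow_sub₀ hqpos, zpow_sub₀ hqpos, zpow_natCast, zpow_natCast]
    norm_cast
    field_simp
  rw [hnum, hpow]
  refine ⟨fun _ hlt ↦ ?_, fun _ heq ↦ ?_, fun heq ↦ ?_⟩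
  · rw [h1 hlt]; ring
  · rw [h2 heq]; ring
  · have hp1 : p ^ s = 1 := by
      have : p ^ s * n₀ = 1 * n₀ := by rw [← hn₀, heq, one_mul]
      exact Nat.eq_of_mul_eq_mul_right hn₀pos this
    rw [h3 hp1, heq]
    congr 1
    field_simp
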